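/- Let $n\ge 1$. A $GBS_n$ group is a group $G$ together with a decomposition as the fundamental group of a finite connected graph of groups in which all vertex and edge groups are isomorphic to $\mathbb Z^n$; let $T$ be the corresponding Bass--Serre tree. Choose a vertex $v_0$ of $T$, a subgroup $A\cong\mathbb Z^n$ of finite index in $\mathrm{Stab}_G(v_0)\cong\mathbb Z^n$, and an ordered basis $a_1,\dots,a_n$ of $A$. For every $g\in G$ the subgroups $A$ and $g^{-1}Ag$ are commensurable, so there are an integer $m>0$ and integers $g_{ij}$ with $g a_j^m g^{-1}=a_1^{g_{1j}}\cdots a_n^{g_{nj}}$ for $j=1,\dots,n$. The modular homomorphism $\mathcal M:G\to GL(n,\mathbb Q)$ sends $g$ to the matrix $(g_{ij}/m)_{i,j}$ (which does not depend on $m$), and the monodromy of $G$ is the image $\mathcal M(G)$; another choice of $v_0$, $A$ and the basis changes $\mathcal M$ only by a conjugation in $GL(n,\mathbb Q)$. Theorem. If $G$ is a $GBS_n$ group with finite monodromy, then $G$ has a subgroup of finite index that is isomorphic to $\mathbb Z^n\times F_r$ for some integer $r\ge 0$, where $F_r$ is the free group of rank $r$. -/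

import Mathlib

universe u w

/-- A graph of groups. The underlying graph may have loops and multiple edges. Each (geometric)
edge `e` is listed once, with a chosen orientation from `src e` to `tgt e`, and its group embeds in
the groups of its two end points. -/
structure GraphOfGroups where
  Vertex : Type u
  Edge : Type u
  src : Edge → Vertex
  tgt : Edge → Vertex
  vertexGroup : Vertex → Type w
  edgeGroup : Edge → Type w
  [vertexGroupInst : ∀ v, Group (vertexGroup v)]
  [edgeGroupInst : ∀ e, Group (edgeGroup e)]
  srcHom : ∀ e, edgeGroup e →* vertexGroup (src e)
  tgtHom : ∀ e, edgeGroup e →* vertexGroup (tgt e)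
  srcHom_injective : ∀ e, Function.Injective (srcHom e)
  tgtHom_injective : ∀ e, Function.Injective (tgtHom e)

attribute [instance] GraphOfGroups.vertexGroupInst GraphOfGroups.edgeGroupInst

namespace GraphOfGroups

variable (Γ : GraphOfGroups.{u, w})

/-- The set of edges `T` is (the edge set of) a maximal tree, that is, a spanning tree, of the
underlying graph: it has no loops, no two edges with the same end points, and the simple graph
it defines on the set of all vertices is a tree. -/
structure IsMaximalTree (T : Set Γ.Edge) : Prop where
  no_loop : ∀ e ∈ T, Γ.src e ≠ Γ.tgt e
  no_multiple : ∀ e ∈ T, ∀ f ∈ T, s(Γ.src e, Γ.tgt e) = s(Γ.src f, Γ.tgt f) → e = f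
  isTree : (SimpleGraph.fromRel fun v v' => ∃ e ∈ T, Γ.src e = v ∧ Γ.tgt e = v').IsTree

/-- The free product of all vertex groups and of the free group on the edges. -/
abbrev FreeProd : Type (max u w) :=
  Monoid.Coprod (Monoid.CoprodI Γ.vertexGroup) (FreeGroup Γ.Edge)

/-- The inclusion of a vertex group in the free product. -/
def freeVertex (v : Γ.Vertex) : Γ.vertexGroup v →* Γ.FreeProd :=
  Monoid.Coprod.inl.comp Monoid.CoprodI.of

/-- The letter of an edge in the free product. -/
def freeEdge (e : Γ.Edge) : Γ.FreeProd :=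
  Monoid.Coprod.inr (FreeGroup.of e)

/-- The relators `t_e * tgt_e(x) * t_e⁻¹ * src_e(x)⁻¹` for every edge `e` and `x` in the edge group,
and `t_e` for every edge `e` of the maximal tree `T`. -/
def relators (T : Set Γ.Edge) : Set Γ.FreeProd :=
  {r | ∃ (e : Γ.Edge) (x : Γ.edgeGroup e),
      r = Γ.freeEdge e * Γ.freeVertex (Γ.tgt e) (Γ.tgtHom e x) * (Γ.freeEdge e)⁻¹ *
        (Γ.freeVertex (Γ.src e) (Γ.srcHom e x))⁻¹} ∪
  Γ.freeEdge '' T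

/-- The fundamental group of the graph of groups `Γ` with respect to the maximal tree `T`. -/
abbrev FundamentalGroup (T : Set Γ.Edge) : Type (max u w) :=
  Γ.FreeProd ⧸ Subgroup.normalClosure (Γ.relators T)

/-- The canonical homomorphism from a vertex group to the fundamental group. -/
def ofVertex (T : Set Γ.Edge) (v : Γ.Vertex) : Γ.vertexGroup v →* Γ.FundamentalGroup T :=
  (QuotientGroup.mk' _).comp (Γ.freeVertex v)

/-- The element of the fundamental group given by an edge (a stable letter if the edge does not
belong to the maximal tree, and the identity otherwise). -/
def ofEdge (T : Set Γ.Edge) (e : Γ.Edge) : Γ.FundamentalGroup T :=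
  QuotientGroup.mk' _ (Γ.freeEdge e)

variable {Γ}

theorem ofEdge_eq_one {T : Set Γ.Edge} {e : Γ.Edge} (he : e ∈ T) : Γ.ofEdge T e = 1 :=
  (QuotientGroup.eq_one_iff _).2 (Subgroup.subset_normalClosure (Or.inr ⟨e, he, rfl⟩))

theorem ofEdge_conj (T : Set Γ.Edge) (e : Γ.Edge) (x : Γ.edgeGroup e) :
    Γ.ofEdge T e * Γ.ofVertex T (Γ.tgt e) (Γ.tgtHom e x) * (Γ.ofEdge T e)⁻¹ =
      Γ.ofVertex T (Γ.src e) (Γ.srcHom e x) := by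
  have h : QuotientGroup.mk' (Subgroup.normalClosure (Γ.relators T))
      (Γ.freeEdge e * Γ.freeVertex (Γ.tgt e) (Γ.tgtHom e x) * (Γ.freeEdge e)⁻¹ *
        (Γ.freeVertex (Γ.src e) (Γ.srcHom e x))⁻¹) = 1 :=
    (QuotientGroup.eq_one_iff _).2 (Subgroup.subset_normalClosure (Or.inl ⟨e, x, rfl⟩))
  simp only [map_mul, map_inv] at h
  exact mul_inv_eq_one.1 h

/-- The fundamental group is generated by the vertex groups and the edge letters. -/
theorem eq_top_of_mem {T : Set Γ.Edge} (K : Subgroup (Γ.FundamentalGroup T))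
    (hv : ∀ v x, Γ.ofVertex T v x ∈ K) (he : ∀ e, Γ.ofEdge T e ∈ K) : K = ⊤ := by
  refine (Subgroup.eq_top_iff' K).2 fun g => ?_
  obtain ⟨y, rfl⟩ := QuotientGroup.mk'_surjective _ g
  change y ∈ K.comap (QuotientGroup.mk' _)
  induction y using Monoid.Coprod.induction_on with
  | inl m =>
    induction m using Monoid.CoprodI.induction_on with
    | one => rw [map_one]; exact one_mem _
    | of v x => exact hv v x
    | mul x y hx hy => rw [map_mul]; exact mul_mem hx hy
  | inr m =>
    induction m using FreeGroup.induction_on with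
    | C1 => rw [map_one]; exact one_mem _
    | of e => exact he e
    | inv_of e h => rw [map_inv]; exact inv_mem h
    | mul x y hx hy => rw [map_mul]; exact mul_mem hx hy
  | mul x y hx hy => exact mul_mem hx hy

end GraphOfGroups

/-- An injective homomorphism between groups isomorphic to `ℤ^n` has image of finite index. -/
theorem range_index_ne_zero_of_zn {n : ℕ} {P Q : Type*} [Group P] [Group Q]
    (p : P ≃* Multiplicative (Fin n → ℤ)) (q : Q ≃* Multiplicative (Fin n → ℤ))
    (f : P →* Q) (hf : Function.Injective f) : f.range.index ≠ 0 := by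
  let F : (Fin n → ℤ) →+ (Fin n → ℤ) :=
    MonoidHom.toAdditive ((q.toMonoidHom.comp f).comp p.symm.toMonoidHom)
  have hF : Function.Injective F := q.injective.comp (hf.comp p.symm.injective)
  let L : (Fin n → ℤ) →ₗ[ℤ] (Fin n → ℤ) := F.toIntLinearMap
  have hL : Function.Injective L := hF
  have hfin : Finite ((Fin n → ℤ) ⧸ LinearMap.range L) :=
    Submodule.finiteQuotientOfFreeOfRankEq _ (LinearMap.finrank_range_of_inj hL)
  have hi : (LinearMap.range L).toAddSubgroup.index ≠ 0 :=
    AddSubgroup.index_ne_zero_of_finite (hH := hfin)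
  have he : f.range.map q.toMonoidHom =
      AddSubgroup.toSubgroup (LinearMap.range L).toAddSubgroup := by
    ext y
    constructor
    · rintro ⟨_, ⟨x, rfl⟩, rfl⟩
      refine ⟨(p x).toAdd, ?_⟩
      change q (f (p.symm (p x))) = q (f x)
      rw [p.symm_apply_apply]
    · rintro ⟨x, rfl⟩
      exact ⟨_, ⟨p.symm (Multiplicative.ofAdd x), rfl⟩, rfl⟩
  have h2 : (f.range.map q.toMonoidHom).index = f.range.index :=
    Subgroup.index_map_equiv _ q
  rw [← h2, he]
  exact hi

/-- A decomposition of the group `G` as a generalised Baumslag-Solitar group of rank `n`, that is,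
as the fundamental group of a finite (connected) graph of groups with all vertex and edge groups
isomorphic to `ℤ^n`. The connectedness of the graph is part of the existence of `tree`. -/
structure GBSDecomposition (n : ℕ) (G : Type*) [Group G] where
  graph : GraphOfGroups.{u, w}
  finite_vertex : Finite graph.Vertex
  finite_edge : Finite graph.Edge
  vertex_zn : ∀ v, Nonempty (graph.vertexGroup v ≃* Multiplicative (Fin n → ℤ))
  edge_zn : ∀ e, Nonempty (graph.edgeGroup e ≃* Multiplicative (Fin n → ℤ))
  tree : Set graph.Edge
  isMaximalTree : graph.IsMaximalTree tree
  iso : G ≃* graph.FundamentalGroup tree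

namespace GBSDecomposition

open scoped Pointwise

variable {n : ℕ} {G : Type*} [Group G] (D : GBSDecomposition.{u, w} n G)

/-- The homomorphism from the group of the vertex `v` to `G`. -/
def vertexHom (v : D.graph.Vertex) : D.graph.vertexGroup v →* G :=
  D.iso.symm.toMonoidHom.comp (D.graph.ofVertex D.tree v)

/-- The stabiliser of the vertex `h • v` of the Bass-Serre tree, where the vertices of that tree
over the vertex `v` of the graph are the cosets of (the image of) the group of `v` in `G`: it is the
conjugate by `h` of the image of the group of `v`. -/
def stabilizer (v : D.graph.Vertex) (h : G) : Subgroup G :=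
  (D.vertexHom v).range.map (MulAut.conj h).toMonoidHom

/-- A choice of a base `ℤ^n`-subgroup with an ordered basis: a vertex of the Bass-Serre tree, a
subgroup `A` of finite index in its stabiliser, and a basis of `A`, given as an isomorphism
from `ℤ^n` to `A`. -/
structure Base where
  vertex : D.graph.Vertex
  translate : G
  A : Subgroup G
  A_le : A ≤ D.stabilizer vertex translate
  A_finiteIndex : A.IsFiniteRelIndex (D.stabilizer vertex translate)
  basis : Multiplicative (Fin n → ℤ) ≃* A

/-- The element of `G` given by an edge. -/
def edgeElem (e : D.graph.Edge) : G := D.iso.symm (D.graph.ofEdge D.tree e)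

theorem edgeElem_conj (e : D.graph.Edge) (x : D.graph.edgeGroup e) :
    D.edgeElem e * D.vertexHom (D.graph.tgt e) (D.graph.tgtHom e x) * (D.edgeElem e)⁻¹ =
      D.vertexHom (D.graph.src e) (D.graph.srcHom e x) := by
  have h := congrArg D.iso.symm (GraphOfGroups.ofEdge_conj D.tree e x)
  simpa only [map_mul, map_inv] using! h

theorem eq_top_of_mem (K : Subgroup G) (hv : ∀ v x, D.vertexHom v x ∈ K)
    (he : ∀ e, D.edgeElem e ∈ K) : K = ⊤ := by
  have h := GraphOfGroups.eq_top_of_mem (K.comap D.iso.symm.toMonoidHom) hv he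
  refine (Subgroup.eq_top_iff' K).2 fun g => ?_
  have h2 : D.iso g ∈ K.comap D.iso.symm.toMonoidHom := by rw [h]; trivial
  have h3 : D.iso.symm (D.iso g) ∈ K := h2
  rwa [D.iso.symm_apply_apply] at h3

theorem commensurable_map_range {P Q : Type*} [Group P] [Group Q] (f : P →* Q) (k : Q →* G)
    (hf : f.range.index ≠ 0) : Subgroup.Commensurable (k.comp f).range k.range := by
  have hle : (k.comp f).range ≤ k.range := by
    rintro _ ⟨x, rfl⟩
    exact ⟨f x, rfl⟩
  refine ⟨?_, ?_⟩
  · rw [← MonoidHom.map_range, MonoidHom.range_eq_map k, Subgroup.relIndex_map_map, top_sup_eq,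
      Subgroup.relIndex_top_right]
    exact fun h0 => hf (Nat.eq_zero_of_zero_dvd (h0 ▸ Subgroup.index_dvd_of_le le_sup_left))
  · rw [Subgroup.relIndex_eq_one.2 hle]
    exact one_ne_zero

theorem commensurable_edge (e : D.graph.Edge) :
    Subgroup.Commensurable
      (ConjAct.toConjAct (D.edgeElem e) • (D.vertexHom (D.graph.tgt e)).range)
      (D.vertexHom (D.graph.src e)).range := by
  obtain ⟨p⟩ := D.edge_zn e
  obtain ⟨q⟩ := D.vertex_zn (D.graph.src e)
  obtain ⟨r⟩ := D.vertex_zn (D.graph.tgt e)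
  have h1 := commensurable_map_range (D.graph.srcHom e) (D.vertexHom (D.graph.src e))
    (range_index_ne_zero_of_zn p q _ (D.graph.srcHom_injective e))
  have h2 := commensurable_map_range (D.graph.tgtHom e) (D.vertexHom (D.graph.tgt e))
    (range_index_ne_zero_of_zn p r _ (D.graph.tgtHom_injective e))
  have h3 : ConjAct.toConjAct (D.edgeElem e) •
      ((D.vertexHom (D.graph.tgt e)).comp (D.graph.tgtHom e)).range =
      ((D.vertexHom (D.graph.src e)).comp (D.graph.srcHom e)).range := by
    ext y
    rw [Subgroup.mem_smul_pointwise_iff_exists]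
    constructor
    · rintro ⟨_, ⟨x, rfl⟩, rfl⟩
      exact ⟨x, by
        rw [ConjAct.smul_def, ConjAct.ofConjAct_toConjAct]; exact (D.edgeElem_conj e x).symm⟩
    · rintro ⟨x, rfl⟩
      exact ⟨_, ⟨x, rfl⟩, by
        rw [ConjAct.smul_def, ConjAct.ofConjAct_toConjAct]; exact D.edgeElem_conj e x⟩
  exact ((h2.conj _).symm.trans (h3 ▸ Subgroup.Commensurable.refl _)).trans h1

/-- The images of any two vertex groups are commensurable. -/
theorem commensurable_vertex (v v' : D.graph.Vertex) :
    Subgroup.Commensurable (D.vertexHom v).range (D.vertexHom v').range := by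
  obtain ⟨W⟩ := D.isMaximalTree.isTree.connected v v'
  induction W with
  | nil => exact Subgroup.Commensurable.refl _
  | cons h _ ih =>
    have key : ∀ e ∈ D.tree, Subgroup.Commensurable (D.vertexHom (D.graph.tgt e)).range
        (D.vertexHom (D.graph.src e)).range := by
      intro e he
      have h1 : D.edgeElem e = 1 := by
        rw [edgeElem, GraphOfGroups.ofEdge_eq_one he, map_one]
      have h2 := D.commensurable_edge e
      rwa [h1, map_one, one_smul] at h2
    refine Subgroup.Commensurable.trans ?_ ih
    obtain ⟨-, ⟨e, he, rfl, rfl⟩ | ⟨e, he, rfl, rfl⟩⟩ := h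
    · exact (key e he).symm
    · exact key e he

theorem commensurator_vertex (v : D.graph.Vertex) (g : G) :
    g ∈ Subgroup.Commensurable.commensurator (D.vertexHom v).range := by
  have h : Subgroup.Commensurable.commensurator (D.vertexHom v).range = ⊤ := by
    refine D.eq_top_of_mem _ (fun v' x => ?_) fun e => ?_
    · rw [(D.commensurable_vertex v v').eq, Subgroup.Commensurable.commensurator_mem_iff]
      rw [show ConjAct.toConjAct (D.vertexHom v' x) • (D.vertexHom v').range =
        (D.vertexHom v').range from
          Subgroup.conj_smul_eq_self_of_mem (H := (D.vertexHom v').range) ⟨x, rfl⟩]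
    · rw [Subgroup.Commensurable.commensurator_mem_iff]
      exact (((D.commensurable_vertex v _).conj _).trans (D.commensurable_edge e)).trans
        (D.commensurable_vertex _ v)
  rw [h]
  trivial

variable {D}

namespace Base

variable (b : D.Base)

/-- The element `a_1 ^ x_1 * ... * a_n ^ x_n` of the base subgroup, where `a_1, ..., a_n` is the
chosen basis. -/
def elem (x : Fin n → ℤ) : G := (b.basis (Multiplicative.ofAdd x) : G)

/-- The `j`-th element `a_j` of the chosen basis. -/
def gen (j : Fin n) : G := b.elem (Pi.single j 1)

/-- `M` is the modular matrix of `g`: for some integer `m > 0`, all the elements `g a_j ^ m g⁻¹` lie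
in the base subgroup, and if `N` is the integer matrix with
`g a_j ^ m g⁻¹ = a_1 ^ N_{1j} * ... * a_n ^ N_{nj}`, then `M_{ij} = N_{ij} / m`. -/
def IsModularMatrix (g : G) (M : Matrix (Fin n) (Fin n) ℚ) : Prop :=
  ∃ (m : ℕ) (N : Matrix (Fin n) (Fin n) ℤ), 0 < m ∧
    (∀ j, g * b.gen j ^ m * g⁻¹ = b.elem fun i => N i j) ∧
    ∀ i j, M i j = (N i j : ℚ) / (m : ℚ)

theorem elem_add (x y : Fin n → ℤ) : b.elem (x + y) = b.elem x * b.elem y := by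
  simp [elem]

theorem elem_nsmul (m : ℕ) (x : Fin n → ℤ) : b.elem (m • x) = b.elem x ^ m := by
  simp only [elem, ofAdd_nsmul, map_pow, Subgroup.coe_pow]

theorem elem_injective : Function.Injective b.elem := fun _ _ h =>
  b.basis.injective (Subtype.ext h)

theorem exists_elem {g : G} (hg : g ∈ b.A) : ∃ x, b.elem x = g :=
  ⟨(b.basis.symm ⟨g, hg⟩).toAdd, by simp [elem]⟩

theorem commensurator_A (g : G) : g ∈ Subgroup.Commensurable.commensurator b.A := by
  have hs : D.stabilizer b.vertex b.translate =
      ConjAct.toConjAct b.translate • (D.vertexHom b.vertex).range := rfl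
  have h1 : Subgroup.Commensurable b.A (D.vertexHom b.vertex).range := by
    have h2 : Subgroup.Commensurable b.A (D.stabilizer b.vertex b.translate) :=
      ⟨b.A_finiteIndex.relIndex_ne_zero, by
        rw [Subgroup.relIndex_eq_one.2 b.A_le]; exact one_ne_zero⟩
    rw [hs] at h2
    exact h2.trans (D.commensurator_vertex b.vertex b.translate)
  rw [h1.eq]
  exact D.commensurator_vertex _ g

theorem exists_isModularMatrix (g : G) : ∃ M, b.IsModularMatrix g M := by
  have h : (ConjAct.toConjAct g⁻¹ • b.A).relIndex b.A ≠ 0 := (b.commensurator_A g⁻¹).1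
  set K := ConjAct.toConjAct g⁻¹ • b.A with hK
  have h1 : ∀ j, ∃ x, b.elem x = g * b.gen j ^ (K.relIndex b.A).factorial * g⁻¹ := by
    intro j
    obtain ⟨k, hk0, hk, hmem⟩ :=
      Subgroup.exists_pow_mem_of_relIndex_ne_zero h (a := b.gen j) (Subtype.coe_prop _)
    obtain ⟨l, hl⟩ := Nat.dvd_factorial hk0 hk
    have h2 : b.gen j ^ (K.relIndex b.A).factorial ∈ K := by
      rw [hl, pow_mul]
      exact pow_mem hmem.1 l
    rw [hK, Subgroup.mem_smul_pointwise_iff_exists] at h2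
    obtain ⟨s, hs, hs2⟩ := h2
    refine b.exists_elem ?_
    rw [← hK] at hs2
    rw [← hs2, ConjAct.smul_def, ConjAct.ofConjAct_toConjAct]
    simpa [mul_assoc] using hs
  choose x hx using h1
  exact ⟨fun i j => (x j i : ℚ) / ((K.relIndex b.A).factorial : ℚ), _, fun i j => x j i,
    Nat.factorial_pos _, fun j => (hx j).symm, fun i j => rfl⟩

theorem isModularMatrix_unique {g : G} {M M' : Matrix (Fin n) (Fin n) ℚ}
    (h : b.IsModularMatrix g M) (h' : b.IsModularMatrix g M') : M = M' := by
  obtain ⟨m, N, hm, hN, hM⟩ := h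
  obtain ⟨m', N', hm', hN', hM'⟩ := h'
  have key : ∀ j, (m' • fun i => N i j) = (m • fun i => N' i j) := by
    intro j
    apply b.elem_injective
    rw [elem_nsmul, elem_nsmul, ← hN, ← hN', conj_pow, conj_pow, ← pow_mul, ← pow_mul, mul_comm]
  ext i j
  have hij := congrFun (key j) i
  simp only [Pi.smul_apply, nsmul_eq_mul] at hij
  have hq : (m' : ℚ) * N i j = m * N' i j := by exact_mod_cast hij
  rw [hM, hM', div_eq_div_iff (by positivity) (by positivity)]
  linarith

/-- Conjugation by `g` on an arbitrary `m`-th power of an element of the base subgroup. -/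
theorem conj_elem {g : G} {m : ℕ} {N : Matrix (Fin n) (Fin n) ℤ}
    (hN : ∀ j, g * b.gen j ^ m * g⁻¹ = b.elem fun i => N i j) (x : Fin n → ℤ) :
    g * b.elem x ^ m * g⁻¹ = b.elem (N.mulVec x) := by
  let F1 : Multiplicative (Fin n → ℤ) →* G :=
    (MulAut.conj g).toMonoidHom.comp
      (b.A.subtype.comp (b.basis.toMonoidHom.comp (powMonoidHom m)))
  let F2 : Multiplicative (Fin n → ℤ) →* G :=
    b.A.subtype.comp (b.basis.toMonoidHom.comp
      (AddMonoidHom.toMultiplicative N.mulVecLin.toAddMonoidHom))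
  have h1 : ∀ y, F1 (Multiplicative.ofAdd y) = g * b.elem y ^ m * g⁻¹ := by
    intro y
    simp [F1, elem]
  have h2 : ∀ y, F2 (Multiplicative.ofAdd y) = b.elem (N.mulVec y) := fun y => rfl
  have h3 : ∀ j, F1 (Multiplicative.ofAdd (Pi.single j 1)) =
      F2 (Multiplicative.ofAdd (Pi.single j 1)) := by
    intro j
    rw [h1, h2]
    have := hN j
    rw [gen] at this
    rw [this, Matrix.mulVec_single_one]
    rfl
  let K : AddSubgroup (Fin n → ℤ) := Subgroup.toAddSubgroup' (F1.eqLocus F2)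
  have hK : ∀ y, y ∈ K := by
    intro y
    rw [← Finset.univ_sum_single y]
    refine AddSubgroup.sum_mem _ fun j _ => ?_
    have : Pi.single j (y j) = y j • (Pi.single j 1 : Fin n → ℤ) := by
      rw [← Pi.single_smul]; simp
    rw [this]
    exact AddSubgroup.zsmul_mem _ (h3 j) _
  rw [← h1, ← h2]
  exact hK x

theorem isModularMatrix_one : b.IsModularMatrix 1 1 := by
  refine ⟨1, 1, one_pos, fun j => ?_, fun i j => ?_⟩
  · rw [gen, pow_one, one_mul, inv_one, mul_one]
    congr 1
    ext i
    simp [Matrix.one_apply, Pi.single_apply]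
  · simp [Matrix.one_apply]

theorem isModularMatrix_mul {g h : G} {M M' : Matrix (Fin n) (Fin n) ℚ}
    (hg : b.IsModularMatrix g M) (hh : b.IsModularMatrix h M') :
    b.IsModularMatrix (g * h) (M * M') := by
  obtain ⟨m, N, hm, hN, hM⟩ := hg
  obtain ⟨m', N', hm', hN', hM'⟩ := hh
  refine ⟨m * m', N * N', Nat.mul_pos hm hm', fun j => ?_, fun i j => ?_⟩
  · have h1 := b.conj_elem hN (fun i => N' i j)
    rw [← hN' j, conj_pow, ← pow_mul, mul_comm m' m] at h1
    rw [mul_inv_rev]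
    simp only [mul_assoc] at h1 ⊢
    rw [h1]
    rfl
  · simp only [Matrix.mul_apply, hM, hM']
    push_cast
    rw [Finset.sum_div]
    exact Finset.sum_congr rfl fun k _ => div_mul_div_comm _ _ _ _

/-- The modular homomorphism `G → GL(n, ℚ)`; it sends `g` to its modular matrix. -/
noncomputable def modularHom : G →* GL (Fin n) ℚ :=
  MonoidHom.toHomUnits
    { toFun := fun g => (b.exists_isModularMatrix g).choose
      map_one' := b.isModularMatrix_unique (b.exists_isModularMatrix 1).choose_spec
        b.isModularMatrix_one
      map_mul' := fun g h => b.isModularMatrix_unique (b.exists_isModularMatrix (g * h)).choose_spec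
        (b.isModularMatrix_mul (b.exists_isModularMatrix g).choose_spec
          (b.exists_isModularMatrix h).choose_spec) }

theorem modularHom_spec (g : G) :
    b.IsModularMatrix g (b.modularHom g : Matrix (Fin n) (Fin n) ℚ) :=
  (b.exists_isModularMatrix g).choose_spec

/-- The monodromy: the image of the modular homomorphism. -/
noncomputable def monodromy : Subgroup (GL (Fin n) ℚ) := b.modularHom.range

end Base

end GBSDecomposition

/-! Rational coordinates with respect to the base subgroup turn every vertex group into a group of
translations of ℚ^n, and conjugation by g changes these coordinates by the modular matrix of g.
Letting vertex groups translate and edge letters act by their modular matrices therefore gives an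
affine representation (`affineHom`) whose linear part is the modular homomorphism. It is injective
on vertex groups, so its kernel is free (`IsMaximalTree.isFreeGroup_ker`).

Let K be the kernel of the modular homomorphism. Finite monodromy makes K a finite-index, hence
finitely generated, subgroup of G. On K the affine representation is a homomorphism τ to ℚ^n with
free kernel. Each element of K centralises a finite-index subgroup of the base; finitely many
generators give one m such that the m-th powers of the base, a copy of ℤ^n, are central in K. This
ℤ^n meets ker τ trivially, and the product with ker τ is the preimage under τ of a finite-index
subgroup of τ(K) (`exists_finiteIndex_range_of_central`). -/

theorem IsFreeGroup.of_injective {G H : Type*} [Group G] [Group H] [IsFreeGroup H] (f : G →* H)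
    (hf : Function.Injective f) : IsFreeGroup G :=
  IsFreeGroup.ofMulEquiv (MonoidHom.ofInjective hf).symm

/-! ### Universal property of the fundamental group -/

namespace GraphOfGroups

variable {Γ : GraphOfGroups.{u, w}} {T : Set Γ.Edge}

/-- The universal property of the fundamental group of a graph of groups. -/
def lift {S : Type*} [Group S] (f : ∀ v, Γ.vertexGroup v →* S) (t : Γ.Edge → S)
    (hrel : ∀ e x, t e * f (Γ.tgt e) (Γ.tgtHom e x) * (t e)⁻¹ = f (Γ.src e) (Γ.srcHom e x))
    (htree : ∀ e ∈ T, t e = 1) : Γ.FundamentalGroup T →* S :=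
  QuotientGroup.lift _ (Monoid.Coprod.lift (Monoid.CoprodI.lift f) (FreeGroup.lift t)) (by
    refine Subgroup.normalClosure_le_normal ?_
    rintro _ (⟨e, x, rfl⟩ | ⟨e, he, rfl⟩)
    · simp [MonoidHom.mem_ker, freeEdge, freeVertex, hrel]
    · simp [MonoidHom.mem_ker, freeEdge, htree e he])

section lift

variable {S : Type*} [Group S] {f : ∀ v, Γ.vertexGroup v →* S} {t : Γ.Edge → S}
  (hrel : ∀ e x, t e * f (Γ.tgt e) (Γ.tgtHom e x) * (t e)⁻¹ = f (Γ.src e) (Γ.srcHom e x))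
  (htree : ∀ e ∈ T, t e = 1)

@[simp]
theorem lift_ofVertex (v : Γ.Vertex) (x : Γ.vertexGroup v) :
    lift f t hrel htree (Γ.ofVertex T v x) = f v x := by
  simp [lift, ofVertex, freeVertex]

@[simp]
theorem lift_ofEdge (e : Γ.Edge) : lift f t hrel htree (Γ.ofEdge T e) = t e := by
  simp [lift, ofEdge, freeEdge]

end lift

theorem hom_ext {S : Type*} [Group S] {f g : Γ.FundamentalGroup T →* S}
    (hv : ∀ v x, f (Γ.ofVertex T v x) = g (Γ.ofVertex T v x))
    (he : ∀ e, f (Γ.ofEdge T e) = g (Γ.ofEdge T e)) : f = g := by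
  have h := eq_top_of_mem (f.eqLocus g) hv he
  refine MonoidHom.ext fun x => ?_
  exact (h ▸ Subgroup.mem_top x : x ∈ f.eqLocus g)

end GraphOfGroups

/-! ### Potentials on trees -/

namespace SimpleGraph

/-- The product of the weights of the darts of a walk. -/
def Walk.holonomy {V S : Type*} [Group S] {X : SimpleGraph V} (d : V → V → S) {u : V} :
    ∀ {v : V}, X.Walk v u → S
  | _, .nil => 1
  | v, .cons (v := v') _ p => d v v' * p.holonomy d

/-- An antisymmetric weight on the darts of a tree is the difference of a potential. -/
theorem IsTree.exists_potential {V S : Type*} [Group S] {X : SimpleGraph V} (hX : X.IsTree)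
    (d : V → V → S) (hd : ∀ u v, X.Adj u v → d v u = (d u v)⁻¹) :
    ∃ P : V → S, ∀ u v, X.Adj u v → d u v * P v = P u := by
  classical
  -- Root the tree at `r`; the potential at a vertex is the product of the weights along its path to
  -- `r`.
  obtain ⟨r⟩ := hX.connected.nonempty
  choose p hp huniq using fun v => hX.existsUnique_path v r
  have key : ∀ u v (h : X.Adj u v), u ∉ (p v).support →
      d u v * (p v).holonomy d = (p u).holonomy d := by
    intro u v h hu
    rw [← huniq u (.cons h (p v)) ((hp v).cons hu)]
    rfl
  refine ⟨fun v => (p v).holonomy d, fun u v h => ?_⟩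
  by_cases hu : u ∈ (p v).support
  · have hv : v ∉ (p u).support := by
      intro hv
      have h1 : ((p v).dropUntil u hu) = p u := huniq u _ ((hp v).dropUntil hu)
      have h2 := congrArg Walk.length ((p v).take_spec hu)
      have h3 : ((p u).dropUntil v hv) = p v := huniq v _ ((hp u).dropUntil hv)
      have h4 := congrArg Walk.length ((p u).take_spec hv)
      rw [Walk.length_append, h1] at h2
      rw [Walk.length_append, h3] at h4
      have h5 : ((p v).takeUntil u hu).length = 0 := by omega
      exact h.ne (Walk.eq_of_length_eq_zero h5).symm
    beta_reduce
    rw [← key v u h.symm hv, hd u v h, mul_inv_cancel_left]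
  · exact key u v h hu

end SimpleGraph

/-! ### Freeness of kernels, by a wreath product embedding -/

namespace GraphOfGroups

variable {Γ : GraphOfGroups.{u, w}} {T : Set Γ.Edge}

open Classical in
theorem IsMaximalTree.exists_potential {S : Type*} [Group S] (hT : Γ.IsMaximalTree T)
    (s : Γ.Edge → S) : ∃ P : Γ.Vertex → S, ∀ e ∈ T, s e * P (Γ.tgt e) = P (Γ.src e) := by
  -- Having no loops and no multiple edges makes the edge of `T` behind a dart, and its direction,
  -- unique; the value 1 off the tree is never used.
  let d : Γ.Vertex → Γ.Vertex → S := fun u v =>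
    if h : ∃ e ∈ T, Γ.src e = u ∧ Γ.tgt e = v then s h.choose
    else if h : ∃ e ∈ T, Γ.src e = v ∧ Γ.tgt e = u then (s h.choose)⁻¹ else 1
  have hd1 : ∀ e ∈ T, d (Γ.src e) (Γ.tgt e) = s e := by
    intro e he
    have h : ∃ f ∈ T, Γ.src f = Γ.src e ∧ Γ.tgt f = Γ.tgt e := ⟨e, he, rfl, rfl⟩
    simp only [d, dif_pos h]
    congr 1
    exact hT.no_multiple _ h.choose_spec.1 _ he
      (by rw [h.choose_spec.2.1, h.choose_spec.2.2])
  have hd2 : ∀ e ∈ T, d (Γ.tgt e) (Γ.src e) = (s e)⁻¹ := by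
    intro e he
    have h0 : ¬ ∃ f ∈ T, Γ.src f = Γ.tgt e ∧ Γ.tgt f = Γ.src e := by
      rintro ⟨f, hf, h1, h2⟩
      have : f = e := hT.no_multiple _ hf _ he (by rw [h1, h2, Sym2.eq_swap])
      subst this
      exact hT.no_loop _ he h1
    have h : ∃ f ∈ T, Γ.src f = Γ.src e ∧ Γ.tgt f = Γ.tgt e := ⟨e, he, rfl, rfl⟩
    simp only [d, dif_neg h0, dif_pos h]
    congr 2
    exact hT.no_multiple _ h.choose_spec.1 _ he
      (by rw [h.choose_spec.2.1, h.choose_spec.2.2])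
  obtain ⟨P, hP⟩ := hT.isTree.exists_potential d (by
    rintro u v ⟨-, ⟨e, he, rfl, rfl⟩ | ⟨e, he, rfl, rfl⟩⟩
    · rw [hd1 e he, hd2 e he]
    · rw [hd1 e he, hd2 e he, inv_inv])
  refine ⟨P, fun e he => ?_⟩
  rw [← hd1 e he]
  exact hP _ _ ⟨hT.no_loop e he, Or.inl ⟨e, he, rfl, rfl⟩⟩

theorem IsMaximalTree.eq_of_edges {S : Type*} (hT : Γ.IsMaximalTree T) (P : Γ.Vertex → S)
    (hP : ∀ e ∈ T, P (Γ.tgt e) = P (Γ.src e)) (v v' : Γ.Vertex) : P v = P v' := by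
  obtain ⟨W⟩ := hT.isTree.connected v v'
  induction W with
  | nil => rfl
  | cons h _ ih =>
    rw [← ih]
    obtain ⟨-, ⟨e, he, rfl, rfl⟩ | ⟨e, he, rfl, rfl⟩⟩ := h
    · exact (hP e he).symm
    · exact hP e he

/-- If a homomorphism is injective on a group, the group acts freely on the target by left
translations, so there is an equivariant map from the target to the group. -/
theorem _root_.MonoidHom.exists_equivariant {P R : Type*} [Group P] [Group R] (f : P →* R)
    (hf : Function.Injective f) : ∃ w : R → P, ∀ g x, w (f g * x) = g * w x := by
  -- Every `x` is uniquely `f g` times the representative of its right coset; the map `w` returns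
  -- this `g`.
  let s := QuotientGroup.rightRel f.range
  have h : ∀ x, ∃ g, f g * (Quotient.mk s x).out = x := by
    intro x
    obtain ⟨g, hg⟩ := QuotientGroup.rightRel_apply.1
      (Quotient.exact (s := s) (Quotient.out_eq (Quotient.mk s x)))
    exact ⟨g, by rw [hg]; group⟩
  choose w hw using h
  refine ⟨w, fun g x => hf ?_⟩
  have h1 : Quotient.mk s (f g * x) = Quotient.mk s x :=
    Quotient.sound (s := s) (QuotientGroup.rightRel_apply.2 ⟨g⁻¹, by simp⟩)
  have h2 := hw (f g * x)
  rw [h1] at h2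
  rw [map_mul]
  refine mul_right_cancel (b := (Quotient.mk s x).out) ?_
  rw [h2, mul_assoc, hw]

theorem mulAutArrow_apply_mul {R M : Type*} [Group R] [Monoid M] (r : R) (f : R → M)
    (x : R) : mulAutArrow r f x = f (r⁻¹ * x) := rfl

/-- An edge relation survives conjugation of the two vertex groups by `a` and `b` and a twist of the
stable letter by an element `l` commuting with the edge group. -/
theorem conj_gauge {S : Type*} [Group S] {l t h k : S} (a b : S) (h₁ : t * h * t⁻¹ = k)
    (h₂ : l * k = k * l) :
    a⁻¹ * l * t * b * (b⁻¹ * h * b⁻¹⁻¹) * (a⁻¹ * l * t * b)⁻¹ = a⁻¹ * k * a⁻¹⁻¹ := by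
  rw [← mul_inv_eq_of_eq_mul h₂, ← h₁]
  group

/-- **Kurosh-type theorem.** The kernel of a homomorphism from the fundamental group of a graph of
groups that is injective on the vertex groups is free. -/
theorem IsMaximalTree.isFreeGroup_ker (hT : Γ.IsMaximalTree T) {R : Type*} [Group R]
    (ρ : Γ.FundamentalGroup T →* R) (hρ : ∀ v, Function.Injective (ρ.comp (Γ.ofVertex T v))) :
    IsFreeGroup ρ.ker := by
  -- `F` has one free generator for each edge and each right coset of the image of its edge group in
  -- `R`. For surjective `ρ`, these index the edges of the quotient of the Bass-Serre tree by the
  -- kernel.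
  let q : ∀ e, Setoid R := fun e =>
    QuotientGroup.rightRel (ρ.comp ((Γ.ofVertex T (Γ.src e)).comp (Γ.srcHom e))).range
  let F := FreeGroup (Σ e, Quotient (q e))
  have hq : ∀ e x a, Quotient.mk (q e) (ρ (Γ.ofVertex T _ (Γ.srcHom e a)) * x) =
      Quotient.mk (q e) x := fun e x a =>
    Quotient.sound (s := q e) (QuotientGroup.rightRel_apply.2 ⟨a⁻¹, by simp⟩)
  let ℓ : Γ.Edge → R → F := fun e x => FreeGroup.of ⟨e, Quotient.mk (q e) x⟩
  obtain ⟨P, hP⟩ := hT.exists_potential ℓ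
  choose w' hw' using fun v => (ρ.comp (Γ.ofVertex T v)).exists_equivariant (hρ v)
  let w : Γ.Vertex → R → Γ.FundamentalGroup T := fun v x => Γ.ofVertex T v (w' v x)
  have hw : ∀ v g x, w v (ρ (Γ.ofVertex T v g) * x) = Γ.ofVertex T v g * w v x := by
    intro v g x
    simp only [w, ← map_mul]
    exact congrArg _ (hw' v g x)
  -- The edge letter read in the frames `w` at its two ends. Equivariance of `w` makes it depend
  -- only on the coset of `x`, so that it defines `θ` on the generators of `F`.
  let η : ∀ e, R → Γ.FundamentalGroup T := fun e x =>
    (w (Γ.src e) x)⁻¹ * Γ.ofEdge T e * w (Γ.tgt e) ((ρ (Γ.ofEdge T e))⁻¹ * x)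
  have hη : ∀ e x a, η e (ρ (Γ.ofVertex T _ (Γ.srcHom e a)) * x) = η e x := by
    intro e x a
    have h1 : (ρ (Γ.ofEdge T e))⁻¹ * (ρ (Γ.ofVertex T _ (Γ.srcHom e a)) * x) =
        ρ (Γ.ofVertex T _ (Γ.tgtHom e a)) * ((ρ (Γ.ofEdge T e))⁻¹ * x) := by
      rw [← ofEdge_conj]; simp [mul_assoc]
    simp only [η]
    rw [h1, hw, hw, ← ofEdge_conj]
    group
  let θ : F →* Γ.FundamentalGroup T := FreeGroup.lift fun i => η i.1 i.2.out
  have hθ : ∀ e x, θ (ℓ e x) = η e x := by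
    intro e x
    obtain ⟨a, ha⟩ := QuotientGroup.rightRel_apply.1
      (Quotient.exact (s := q e) (Quotient.out_eq (Quotient.mk (q e) x)))
    have h1 : x = ρ (Γ.ofVertex T _ (Γ.srcHom e a)) * (Quotient.mk (q e) x).out := by
      change ρ (Γ.ofVertex T _ (Γ.srcHom e a)) = _ at ha
      rw [ha]; group
    calc θ (ℓ e x) = η e (Quotient.mk (q e) x).out := FreeGroup.lift_apply_of
      _ = η e x := (hη e _ a).symm.trans (congrArg (η e) h1.symm)
  obtain ⟨v₀⟩ := hT.isTree.connected.nonempty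
  -- Along a tree edge, `η` is the quotient of the two frames and `P` changes by the label, so the
  -- changes cancel.
  have hW : ∀ x v, w v x * θ (P v x) = w v₀ x * θ (P v₀ x) := by
    intro x v
    refine hT.eq_of_edges (fun v => w v x * θ (P v x)) (fun e he => ?_) v v₀
    simp only [← hP e he, Pi.mul_apply, map_mul, hθ, η, ofEdge_eq_one he]
    simp [mul_assoc]
  let W : R → Γ.FundamentalGroup T := fun x => w v₀ x * θ (P v₀ x)
  have hWv : ∀ v x, W x = w v x * θ (P v x) := fun v x => (hW x v).symm
  -- Each edge letter carries its label in the function part. Conjugating by the potential `P` makes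
  -- the tree letters trivial, as the presentation requires.
  let Φ : Γ.FundamentalGroup T →* (R → F) ⋊[mulAutArrow] R := lift
    (fun v => (MulAut.conj (SemidirectProduct.inl (P v))⁻¹).toMonoidHom.comp
      (SemidirectProduct.inr.comp (ρ.comp (Γ.ofVertex T v))))
    (fun e => (SemidirectProduct.inl (P (Γ.src e)))⁻¹ * SemidirectProduct.inl (ℓ e) *
      SemidirectProduct.inr (ρ (Γ.ofEdge T e)) * SemidirectProduct.inl (P (Γ.tgt e)))
    (by
      intro e a
      have h1 : SemidirectProduct.inl (φ := mulAutArrow) (ℓ e) *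
          SemidirectProduct.inr (ρ (Γ.ofVertex T _ (Γ.srcHom e a))) =
          SemidirectProduct.inr (ρ (Γ.ofVertex T _ (Γ.srcHom e a))) *
          SemidirectProduct.inl (ℓ e) := by
        ext x
        · have := hq e x a⁻¹
          simp only [map_inv] at this
          simp [ℓ, -mulAutArrow_apply_apply, mulAutArrow_apply_mul, this]
        · simp
      refine conj_gauge _ _ ?_ h1
      simp only [MonoidHom.comp_apply, ← map_mul, ← map_inv, ofEdge_conj])
    (by
      intro e he
      simp [ofEdge_eq_one he, ← hP e he])
  let δ : Γ.FundamentalGroup T →* (R → Γ.FundamentalGroup T) ⋊[mulAutArrow] R :=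
    { toFun := fun g => ⟨fun _ => g, ρ g⟩
      map_one' := by ext <;> simp
      map_mul' := fun g h => SemidirectProduct.ext rfl (map_mul ρ g h) }
  let Θ : (R → F) ⋊[mulAutArrow] R →* (R → Γ.FundamentalGroup T) ⋊[mulAutArrow] R :=
    SemidirectProduct.map (θ.compLeft R) (MonoidHom.id R) (fun g => by ext; rfl)
  -- Applying `θ` in every coordinate recovers the constant embedding up to conjugation by `W`; this
  -- is what shows that `Φ` loses no information, without normal forms.
  have main : Θ.comp Φ = (MulAut.conj (SemidirectProduct.inl W)⁻¹).toMonoidHom.comp δ := by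
    refine hom_ext (fun v g => ?_) (fun e => ?_)
    · ext y
      · have h1 := hw v g⁻¹ y
        simp only [map_inv] at h1
        simp [Φ, Θ, δ, -mulAutArrow_apply_apply, mulAutArrow_apply_mul, hWv v, h1, mul_assoc]
      · simp [Φ, Θ, δ]
    · ext y
      · simp [Φ, Θ, δ, -mulAutArrow_apply_apply, mulAutArrow_apply_mul, hWv (Γ.src e) y,
          hWv (Γ.tgt e) ((ρ (Γ.ofEdge T e))⁻¹ * y), hθ, η, mul_assoc]
      · simp [Φ, Θ, δ]
  have hΦ : ∀ g, (Φ g).right = ρ g := by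
    intro g
    have := congrArg (fun f => (f g).right) main
    simpa [Θ, δ] using this
  -- The kernel does not permute the coordinates, so evaluation at 1 is multiplicative there.
  -- Following it by `θ` gives conjugation by `W 1`, so `ψ` is injective and Nielsen-Schreier
  -- applies.
  let ψ : ρ.ker →* F :=
    { toFun := fun g => (Φ g).left 1
      map_one' := by simp
      map_mul' := fun g h => by
        have : ρ g = 1 := g.2
        simp [hΦ, this] }
  have hψ : Function.Injective ψ := by
    refine (injective_iff_map_eq_one ψ).2 fun g hg => ?_
    have h1 := congrArg (fun f => (f g).left 1) main
    have h2 : ρ g = 1 := g.2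
    have h3 : (Φ g).left 1 = 1 := hg
    have h4 : 1 = (W 1)⁻¹ * (g : Γ.FundamentalGroup T) * W 1 := by simpa [Θ, δ, h2, h3] using h1
    refine Subtype.ext ?_
    rwa [eq_comm, mul_assoc, inv_mul_eq_one, eq_comm, mul_eq_right] at h4
  exact .of_injective ψ hψ

end GraphOfGroups

/-! ### Rational coordinates and the modular homomorphism -/

namespace GBSDecomposition

variable {n : ℕ} {G : Type*} [Group G]

theorem fg (D : GBSDecomposition.{u, w} n G) : Group.FG G := by
  have := D.finite_vertex
  have := D.finite_edge
  have h1 : ∀ v, (D.vertexHom v).range.FG := by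
    intro v
    obtain ⟨e⟩ := D.vertex_zn v
    have : Group.FG (D.graph.vertexGroup v) :=
      Group.fg_of_surjective (f := e.symm.toMonoidHom) e.symm.surjective
    exact (Group.fg_iff_subgroup_fg _).1 inferInstance
  have h2 : ((⨆ v, (D.vertexHom v).range) ⊔ Subgroup.closure (Set.range D.edgeElem)).FG :=
    (Subgroup.FG.iSup _ h1).sup ((Group.fg_iff_subgroup_fg _).1 inferInstance)
  have h3 := D.eq_top_of_mem ((⨆ v, (D.vertexHom v).range) ⊔ Subgroup.closure (Set.range D.edgeElem))
    (fun v x => Subgroup.mem_sup_left (Subgroup.mem_iSup_of_mem v ⟨x, rfl⟩))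
    fun e => Subgroup.mem_sup_right (Subgroup.subset_closure ⟨e, rfl⟩)
  rw [h3] at h2
  exact Group.fg_def.2 h2

theorem vertexGroup_comm (D : GBSDecomposition.{u, w} n G) (v : D.graph.Vertex)
    (x y : D.graph.vertexGroup v) : Commute x y := by
  obtain ⟨e⟩ := D.vertex_zn v
  refine e.injective ?_
  rw [map_mul, map_mul, mul_comm]

variable {D : GBSDecomposition.{u, w} n G}

namespace Base

variable (b : D.Base)

/-- The vector `q` gives the rational coordinates of `g`: some positive power `g ^ m` belongs to the
base subgroup and has the coordinates `m * q`. -/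
def IsCoord (g : G) (q : Fin n → ℚ) : Prop :=
  ∃ (m : ℕ) (x : Fin n → ℤ), 0 < m ∧ g ^ m = b.elem x ∧ ∀ i, (m : ℚ) * q i = x i

variable {b}

theorem IsCoord.unique {g : G} {q q' : Fin n → ℚ} (h : b.IsCoord g q) (h' : b.IsCoord g q') :
    q = q' := by
  obtain ⟨m, x, hm, hg, hq⟩ := h
  obtain ⟨m', x', hm', hg', hq'⟩ := h'
  have key : m' • x = m • x' := by
    apply b.elem_injective
    rw [elem_nsmul, elem_nsmul, ← hg, ← hg', ← pow_mul, ← pow_mul, mul_comm]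
  ext i
  have hi := congrFun key i
  simp only [Pi.smul_apply, nsmul_eq_mul] at hi
  have h1 : (m' : ℚ) * x i = m * x' i := by exact_mod_cast hi
  rw [← hq, ← hq'] at h1
  have : (m : ℚ) * m' ≠ 0 := by positivity
  refine mul_left_cancel₀ this ?_
  linarith

theorem isCoord_elem (x : Fin n → ℤ) : b.IsCoord (b.elem x) fun i => x i :=
  ⟨1, x, one_pos, by simp, by simp⟩

theorem elem_zero : b.elem 0 = 1 := by simp [elem]

theorem elem_commute (x y : Fin n → ℤ) : Commute (b.elem x) (b.elem y) := by
  rw [Commute, SemiconjBy, ← elem_add, ← elem_add, add_comm]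

theorem isCoord_one : b.IsCoord 1 0 := ⟨1, 0, one_pos, by simp [elem_zero], by simp⟩

theorem IsCoord.mul {g g' : G} {q q' : Fin n → ℚ} (h : b.IsCoord g q) (h' : b.IsCoord g' q')
    (hc : Commute g g') : b.IsCoord (g * g') (q + q') := by
  obtain ⟨m, x, hm, hg, hq⟩ := h
  obtain ⟨m', x', hm', hg', hq'⟩ := h'
  refine ⟨m * m', m' • x + m • x', Nat.mul_pos hm hm', ?_, fun i => ?_⟩
  · rw [hc.mul_pow, pow_mul, hg, mul_comm, pow_mul, hg', elem_add, elem_nsmul, elem_nsmul]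
  · simp only [Pi.add_apply, Pi.smul_apply]
    push_cast
    simp only [← hq, ← hq', Int.nsmul_eq_mul, Int.cast_mul, Int.cast_natCast]
    ring

theorem IsCoord.pow {g : G} {q : Fin n → ℚ} (h : b.IsCoord g q) (k : ℕ) :
    b.IsCoord (g ^ k) (k • q) := by
  induction k with
  | zero => simpa using isCoord_one
  | succ k ih =>
    rw [pow_succ, succ_nsmul]
    exact ih.mul h ((Commute.refl g).pow_left k)

theorem IsCoord.conj {g h : G} {q : Fin n → ℚ} (hg : b.IsCoord g q) :
    b.IsCoord (h * g * h⁻¹) ((b.modularHom h : Matrix (Fin n) (Fin n) ℚ).mulVec q) := by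
  obtain ⟨m, x, hm, hg, hq⟩ := hg
  obtain ⟨m', N, hm', hN, hM⟩ := b.modularHom_spec h
  refine ⟨m * m', N.mulVec x, Nat.mul_pos hm hm', ?_, fun i => ?_⟩
  · rw [conj_pow, pow_mul, hg, b.conj_elem hN]
  · simp only [Matrix.mulVec, dotProduct, hM]
    push_cast
    rw [Finset.mul_sum]
    refine Finset.sum_congr rfl fun j _ => ?_
    rw [← hq]
    field_simp

theorem commensurable_A_vertex (v : D.graph.Vertex) :
    Subgroup.Commensurable b.A (D.vertexHom v).range := by
  have h2 : Subgroup.Commensurable b.A (D.stabilizer b.vertex b.translate) :=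
    ⟨b.A_finiteIndex.relIndex_ne_zero, by
      rw [Subgroup.relIndex_eq_one.2 b.A_le]; exact one_ne_zero⟩
  exact (h2.trans (D.commensurator_vertex b.vertex b.translate)).trans
    (D.commensurable_vertex b.vertex v)

theorem exists_isCoord_vertexHom (v : D.graph.Vertex) (y : D.graph.vertexGroup v) :
    ∃ q, b.IsCoord (D.vertexHom v y) q := by
  obtain ⟨m, hm, -, hmem⟩ := Subgroup.exists_pow_mem_of_relIndex_ne_zero
    (commensurable_A_vertex (b := b) v).1 (a := D.vertexHom v y) ⟨y, rfl⟩
  obtain ⟨x, hx⟩ := b.exists_elem hmem.1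
  have : (m : ℚ) ≠ 0 := by exact_mod_cast hm.ne'
  exact ⟨fun i => x i / m, m, x, hm, hx.symm, fun i => by field_simp⟩

theorem exists_elem_pow_eq_vertexHom (v : D.graph.Vertex) (x : Fin n → ℤ) :
    ∃ k : ℕ, k ≠ 0 ∧ ∃ y, D.vertexHom v y = b.elem x ^ k := by
  obtain ⟨m, hm, -, hmem⟩ := Subgroup.exists_pow_mem_of_relIndex_ne_zero
    (commensurable_A_vertex (b := b) v).2 (a := b.elem x) (Subtype.coe_prop _)
  exact ⟨m, hm.ne', hmem.1⟩

variable (b) in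
/-- The rational coordinates of the elements of a vertex group. -/
noncomputable def coordHom (v : D.graph.Vertex) :
    D.graph.vertexGroup v →* Multiplicative (Fin n → ℚ) where
  toFun y := Multiplicative.ofAdd (b.exists_isCoord_vertexHom v y).choose
  map_one' := (b.exists_isCoord_vertexHom v 1).choose_spec.unique (by
    rw [map_one]; exact isCoord_one)
  map_mul' x y := (b.exists_isCoord_vertexHom v (x * y)).choose_spec.unique (by
    rw [map_mul]
    exact (b.exists_isCoord_vertexHom v x).choose_spec.mul
      (b.exists_isCoord_vertexHom v y).choose_spec ((D.vertexGroup_comm v x y).map _))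

theorem isCoord_coordHom (v : D.graph.Vertex) (y : D.graph.vertexGroup v) :
    b.IsCoord (D.vertexHom v y) (b.coordHom v y).toAdd :=
  (b.exists_isCoord_vertexHom v y).choose_spec

/-- A positive power of each base generator lies in the vertex group, so the images of a ℤ-basis of
that group span ℚ^n. Being n in number, they are linearly independent over ℚ. -/
theorem coordHom_injective (v : D.graph.Vertex) : Function.Injective (b.coordHom v) := by
  obtain ⟨e⟩ := D.vertex_zn v
  let f : (Fin n → ℤ) →+ (Fin n → ℚ) :=
    MonoidHom.toAdditive ((b.coordHom v).comp e.symm.toMonoidHom)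
  have hf : ∀ x, f x = ∑ j, (x j : ℚ) • f (Pi.single j 1) := by
    intro x
    conv_lhs => rw [← Finset.univ_sum_single x, map_sum]
    refine Finset.sum_congr rfl fun j _ => ?_
    have : Pi.single j (x j) = x j • (Pi.single j 1 : Fin n → ℤ) := by
      rw [← Pi.single_smul]; simp
    rw [this, map_zsmul, Int.cast_smul_eq_zsmul]
  have hspan : ⊤ ≤ Submodule.span ℚ (Set.range fun j => f (Pi.single j 1)) := by
    rw [← (Pi.basisFun ℚ (Fin n)).span_eq, Submodule.span_le]
    rintro _ ⟨j, rfl⟩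
    obtain ⟨k, hk, y, hy⟩ := b.exists_elem_pow_eq_vertexHom v (Pi.single j 1)
    have h1 := b.isCoord_coordHom v y
    rw [hy] at h1
    have h2 := h1.unique ((isCoord_elem (Pi.single j 1)).pow k)
    have h3 : f (e y).toAdd = k • (Pi.basisFun ℚ (Fin n)) j := by
      have : f (e y).toAdd = (b.coordHom v y).toAdd :=
      congrArg (fun z => (b.coordHom v z).toAdd) (e.symm_apply_apply y)
      rw [this, h2]
      congr 1
      ext i
      simp [Pi.single_apply]
    have h4 : (Pi.basisFun ℚ (Fin n)) j = (k : ℚ)⁻¹ • f (e y).toAdd := by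
      have : (k : ℚ) ≠ 0 := by exact_mod_cast hk
      rw [h3, ← Nat.cast_smul_eq_nsmul ℚ, inv_smul_smul₀ this]
    rw [h4, hf]
    exact Submodule.smul_mem _ _ (Submodule.sum_mem _ fun i _ =>
      Submodule.smul_mem _ _ (Submodule.subset_span ⟨i, rfl⟩))
  have hli := linearIndependent_of_top_le_span_of_card_eq_finrank hspan (by simp)
  refine (injective_iff_map_eq_one _).2 fun y hy => ?_
  have h1 : f (e y).toAdd = 0 := by
    have : f (e y).toAdd = (b.coordHom v y).toAdd :=
      congrArg (fun z => (b.coordHom v z).toAdd) (e.symm_apply_apply y)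
    rw [this, hy]; rfl
  rw [hf] at h1
  have h2 := Fintype.linearIndependent_iff.1 hli _ h1
  refine e.injective ?_
  rw [map_one]
  refine Multiplicative.toAdd.injective (funext fun i => ?_)
  exact_mod_cast h2 i

/-- A rational matrix fixing a nonzero multiple of every basis vector is the identity. It applies to
vertex groups, which are abelian and commensurable with the base. -/
theorem modularHom_eq_one {g : G} (h : ∀ j, ∃ k : ℕ, k ≠ 0 ∧ Commute g (b.gen j ^ k)) :
    b.modularHom g = 1 := by
  refine Units.ext (Matrix.ext_of_mulVec_single fun j => ?_)
  obtain ⟨k, hk, hc⟩ := h j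
  have h1 := (isCoord_elem (b := b) (Pi.single j 1)).pow k
  have h2 := h1.conj (h := g)
  have h3 := h2.unique (by
    rw [show b.elem (Pi.single j 1) = b.gen j from rfl, hc.eq, mul_inv_cancel_right]; exact h1)
  have h4 : (fun i => ((Pi.single j 1 : Fin n → ℤ) i : ℚ)) = Pi.single j 1 := by
    ext i; simp [Pi.single_apply]
  rw [h4, Matrix.mulVec_smul] at h3
  have h5 := smul_right_injective (Fin n → ℚ) hk h3
  rw [h5, Units.val_one, Matrix.one_mulVec]

theorem modularHom_vertexHom (v : D.graph.Vertex) (y : D.graph.vertexGroup v) :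
    b.modularHom (D.vertexHom v y) = 1 := by
  refine modularHom_eq_one fun j => ?_
  obtain ⟨k, hk, y', hy'⟩ := b.exists_elem_pow_eq_vertexHom v (Pi.single j 1)
  exact ⟨k, hk, by rw [gen, ← hy']; exact (D.vertexGroup_comm v y y').map _⟩

theorem modularHom_elem (x : Fin n → ℤ) : b.modularHom (b.elem x) = 1 :=
  modularHom_eq_one fun _ => ⟨1, one_ne_zero, by rw [pow_one]; exact elem_commute _ _⟩

/-- An element with trivial modular matrix centralises the `m`-th powers of the base subgroup. -/
theorem exists_commute_pow {g : G} (h : b.modularHom g = 1) :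
    ∃ m : ℕ, 0 < m ∧ ∀ x, Commute g (b.elem x ^ m) := by
  obtain ⟨m, N, hm, hN, hM⟩ := b.modularHom_spec g
  refine ⟨m, hm, fun x => ?_⟩
  have h1 := b.conj_elem hN x
  have h2 : N = (m : ℤ) • (1 : Matrix (Fin n) (Fin n) ℤ) := by
    ext i j
    have h3 := hM i j
    rw [h, eq_div_iff (by positivity)] at h3
    have h4 : ((N i j : ℤ) : ℚ) = ((m : ℤ) • (1 : Matrix (Fin n) (Fin n) ℤ)) i j := by
      rw [← h3]
      by_cases hij : i = j <;> simp [hij]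
    exact_mod_cast h4
  rw [h2, Matrix.smul_mulVec, Matrix.one_mulVec, natCast_zsmul, elem_nsmul] at h1
  exact mul_inv_eq_iff_eq_mul.1 h1

end Base

end GBSDecomposition

/-! ### The affine representation -/

/-- The linear action of `GL(n, ℚ)` on `ℚ^n`, written multiplicatively. -/
def glMulAut (n : ℕ) : GL (Fin n) ℚ →* MulAut (Multiplicative (Fin n → ℚ)) where
  toFun M :=
    { toFun := fun x => Multiplicative.ofAdd (M.1.mulVec x.toAdd)
      invFun := fun x => Multiplicative.ofAdd ((M⁻¹).1.mulVec x.toAdd)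
      left_inv := fun x => by
        beta_reduce
        rw [toAdd_ofAdd, Matrix.mulVec_mulVec, ← Units.val_mul]; simp
      right_inv := fun x => by
        beta_reduce
        rw [toAdd_ofAdd, Matrix.mulVec_mulVec, ← Units.val_mul]; simp
      map_mul' := fun x y => by rw [toAdd_mul, Matrix.mulVec_add, ofAdd_add] }
  map_one' := by ext x : 1; simp
  map_mul' M N := by
    ext x : 1
    simp [← Matrix.mulVec_mulVec]

namespace GBSDecomposition.Base

variable {n : ℕ} {G : Type*} [Group G] {D : GBSDecomposition.{u, w} n G} (b : D.Base)

/-- The affine representation of the fundamental group on `ℚ^n`: vertex groups act by translations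
and edge elements act by their modular matrices. -/
noncomputable def affineHom :
    D.graph.FundamentalGroup D.tree →* Multiplicative (Fin n → ℚ) ⋊[glMulAut n] GL (Fin n) ℚ :=
  GraphOfGroups.lift (fun v => SemidirectProduct.inl.comp (b.coordHom v))
    (fun e => SemidirectProduct.inr (b.modularHom (D.edgeElem e)))
    (by
      intro e x
      rw [MonoidHom.comp_apply, MonoidHom.comp_apply, ← map_inv, ← SemidirectProduct.inl_aut]
      congr 1
      -- The edge relation holds because conjugation acts on coordinates by the modular matrix and
      -- coordinates are unique.
      have h1 := (b.isCoord_coordHom _ (D.graph.tgtHom e x)).conj (h := D.edgeElem e)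
      rw [D.edgeElem_conj] at h1
      exact h1.unique (b.isCoord_coordHom _ _))
    (by
      intro e he
      rw [edgeElem, GraphOfGroups.ofEdge_eq_one he, map_one, map_one, map_one])

theorem affineHom_injective (v : D.graph.Vertex) :
    Function.Injective (b.affineHom.comp (D.graph.ofVertex D.tree v)) := by
  intro x y h
  simp only [affineHom, MonoidHom.comp_apply, GraphOfGroups.lift_ofVertex] at h
  exact coordHom_injective v (SemidirectProduct.inl_injective h)

/-- Both sides agree on edge letters by construction and are trivial on vertex groups. Hence the
kernel of the modular homomorphism acts by translations. -/
theorem affineHom_right (g : G) : (b.affineHom (D.iso g)).right = b.modularHom g := by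
  have h : SemidirectProduct.rightHom.comp b.affineHom =
      b.modularHom.comp D.iso.symm.toMonoidHom := by
    refine GraphOfGroups.hom_ext (fun v x => ?_) fun e => ?_
    · have := b.modularHom_vertexHom v x
      simpa [affineHom, vertexHom] using this.symm
    · simp [affineHom, edgeElem]
  simpa using DFunLike.congr_fun h (D.iso g)

/-- The translation part of the affine representation on the kernel of the modular homomorphism. -/
noncomputable def translationHom : b.modularHom.ker →* Multiplicative (Fin n → ℚ) where
  toFun g := (b.affineHom (D.iso g)).left
  map_one' := by simp
  map_mul' g h := by
    have : b.modularHom g = 1 := g.2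
    simp [affineHom_right, this]

/-- The base sits in a conjugate of a vertex group, so the definition does not apply directly; a
positive power lies in a vertex group itself, and ℚ^n is torsion-free. -/
theorem translationHom_elem (x : Fin n → ℤ) :
    b.translationHom ⟨b.elem x, modularHom_elem x⟩ = Multiplicative.ofAdd fun i => (x i : ℚ) := by
  obtain ⟨v⟩ := D.isMaximalTree.isTree.connected.nonempty
  obtain ⟨k, hk, y, hy⟩ := b.exists_elem_pow_eq_vertexHom v x
  have h1 := b.isCoord_coordHom v y
  rw [hy] at h1
  have h2 := h1.unique ((isCoord_elem x).pow k)
  have h3 : (b.translationHom ⟨b.elem x, modularHom_elem x⟩) ^ k = b.coordHom v y := by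
    rw [← map_pow]
    change (b.affineHom (D.iso (b.elem x ^ k))).left = _
    rw [← hy]
    simp [vertexHom, affineHom]
  refine Multiplicative.toAdd.injective (smul_right_injective (Fin n → ℚ) hk ?_)
  exact (congrArg Multiplicative.toAdd h3).trans h2

/-- Trivial linear part and trivial translation part together mean lying in the free kernel of
`affineHom`. -/
theorem isFreeGroup_ker_translationHom : IsFreeGroup b.translationHom.ker := by
  have := D.isMaximalTree.isFreeGroup_ker b.affineHom b.affineHom_injective
  let f : b.translationHom.ker →* b.affineHom.ker :=
    ((D.iso.toMonoidHom.comp b.modularHom.ker.subtype).comp b.translationHom.ker.subtype).codRestrict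
      _ fun g => SemidirectProduct.ext g.2 ((b.affineHom_right _).trans g.1.2)
  refine .of_injective f fun x y h => ?_
  exact Subtype.ext (Subtype.ext (D.iso.injective (congrArg Subtype.val h)))

/-- If the kernel of the modular homomorphism is finitely generated, then it centralises a
finite-index subgroup of the base subgroup. -/
theorem exists_commute_pow_of_fg (h : b.modularHom.ker.FG) :
    ∃ m : ℕ, 0 < m ∧ ∀ g ∈ b.modularHom.ker, ∀ x, Commute g (b.elem x ^ m) := by
  obtain ⟨S, hS⟩ := h
  have hm : ∀ g : S, ∃ m : ℕ, 0 < m ∧ ∀ x, Commute (g : G) (b.elem x ^ m) := fun g =>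
    exists_commute_pow (b := b) (hS ▸ Subgroup.subset_closure g.2 : (g : G) ∈ b.modularHom.ker)
  choose m hm0 hm using hm
  refine ⟨∏ g, m g, Finset.prod_pos fun g _ => hm0 g, fun g hg x => ?_⟩
  rw [← hS] at hg
  have hle : Subgroup.closure (S : Set G) ≤
      Subgroup.centralizer {b.elem x ^ ∏ g, m g} := by
    refine (Subgroup.closure_le _).2 fun g hg => ?_
    obtain ⟨c, hc⟩ := Finset.dvd_prod_of_mem m (Finset.mem_univ (⟨g, hg⟩ : S))
    rw [SetLike.mem_coe, Subgroup.mem_centralizer_singleton_iff, hc, pow_mul]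
    exact ((hm ⟨g, hg⟩ x).pow_right c).eq
  exact Subgroup.mem_centralizer_singleton_iff.1 (hle hg)

end GBSDecomposition.Base

/-! ### The virtual splitting -/

/-- The group surjects onto the free abelian group on its free generators, which is finitely
generated only if there are finitely many of them. -/
theorem IsFreeGroup.nonempty_mulEquiv_fin {G : Type*} [Group G] [IsFreeGroup G] [Group.FG G] :
    ∃ r : ℕ, Nonempty (G ≃* FreeGroup (Fin r)) := by
  let ι := IsFreeGroup.Generators G
  let e : G ≃* FreeGroup ι := IsFreeGroup.toFreeGroup G
  let f : FreeGroup ι →* Multiplicative (ι →₀ ℤ) :=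
    FreeGroup.lift fun i => Multiplicative.ofAdd (Finsupp.single i 1)
  have hf : Function.Surjective (f.comp e.toMonoidHom) := by
    rw [← MonoidHom.range_eq_top, MonoidHom.range_comp, MonoidHom.range_eq_top.2 e.surjective,
      ← MonoidHom.range_eq_map, eq_top_iff]
    intro y _
    change y.toAdd ∈ Subgroup.toAddSubgroup' f.range
    induction y.toAdd using Finsupp.induction_linear with
    | zero => exact zero_mem _
    | add x y hx hy => exact add_mem hx hy
    | single i a =>
      rw [← mul_one a, ← smul_eq_mul, ← Finsupp.smul_single]
      exact zsmul_mem (show Finsupp.single i 1 ∈ Subgroup.toAddSubgroup' f.range from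
        ⟨FreeGroup.of i, FreeGroup.lift_apply_of⟩) a
  have h1 : Group.FG (Multiplicative (ι →₀ ℤ)) := Group.fg_of_surjective hf
  have h2 : Module.Finite ℤ (ι →₀ ℤ) :=
    Module.Finite.iff_addGroup_fg.2 (AddGroup.fg_iff_mul_fg.2 h1)
  have h3 : Finite ι := Module.Finite.finite_basis (Finsupp.basisSingleOne (R := ℤ))
  obtain ⟨r, ⟨c⟩⟩ := Finite.exists_equiv_fin ι
  exact ⟨r, ⟨e.trans (FreeGroup.freeGroupCongr c)⟩⟩

/-- A finitely generated group with a homomorphism to `ℚ^n` whose kernel is free, and with a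
central `ℤ^n` on which this homomorphism is a multiple of the inclusion, is virtually the product
of `ℤ^n` and a free group of finite rank. -/
theorem exists_finiteIndex_range_of_central {n : ℕ} {K : Type*} [Group K] [Group.FG K]
    (τ : K →* Multiplicative (Fin n → ℚ)) [IsFreeGroup τ.ker]
    (s : Multiplicative (Fin n → ℤ) →* K) (hs : ∀ x k, Commute (s x) k) {m : ℕ} (hm : 0 < m)
    (hτ : ∀ x, (τ (s x)).toAdd = fun i => (m : ℚ) * (x.toAdd i : ℚ)) :
    ∃ H : Subgroup K, H.FiniteIndex ∧
      ∃ r : ℕ, Nonempty (H ≃* Multiplicative (Fin n → ℤ) × FreeGroup (Fin r)) := by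
  let f : Multiplicative (Fin n → ℤ) × τ.ker →* K :=
    s.noncommCoprod τ.ker.subtype fun x y => hs x y
  have hmQ : (m : ℚ) ≠ 0 := by exact_mod_cast hm.ne'
  have hf : Function.Injective f := by
    refine (injective_iff_map_eq_one f).2 ?_
    rintro ⟨x, y⟩ hxy
    have h1 : s x * (y : K) = 1 := hxy
    have h2 : τ y = 1 := y.2
    have h3 : τ (s x) = 1 := by
      have := congrArg τ h1
      rwa [map_mul, h2, mul_one, map_one] at this
    have h4 : x = 1 := by
      refine Multiplicative.toAdd.injective (funext fun i => ?_)
      have := congrFun (hτ x) i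
      rw [h3] at this
      have h5 : (0 : ℚ) = m * (x.toAdd i : ℚ) := this
      simpa [hmQ] using h5.symm
    subst h4
    rw [map_one, one_mul] at h1
    exact Prod.ext rfl (Subtype.ext h1)
  -- As a full preimage under `τ`, the image of `f` has an index that can be computed inside the
  -- abelian group `τ.range`.
  have hrange : f.range = (τ.comp s).range.comap τ := by
    ext k
    constructor
    · rintro ⟨⟨x, y⟩, rfl⟩
      have h2 : τ y = 1 := y.2
      exact ⟨x, ((map_mul τ _ _).trans (by rw [Subgroup.subtype_apply, h2, mul_one]; rfl)).symm⟩
    · rintro ⟨x, hx⟩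
      refine ⟨(x, ⟨(s x)⁻¹ * k, ?_⟩), ?_⟩
      · rw [MonoidHom.mem_ker, map_mul, map_inv, ← hx]; simp
      · exact mul_inv_cancel_left _ _
  have hfin : f.range.FiniteIndex := by
    refine ⟨?_⟩
    rw [hrange, Subgroup.index_comap, Subgroup.relIndex]
    set B := (τ.comp s).range.subgroupOf τ.range
    -- The product `d` of the denominators makes a vector integral, and the further factor `m` puts
    -- it in the image of `τ ∘ s`. A finitely generated torsion abelian group is finite.
    have htor : IsMulTorsion (τ.range ⧸ B) := by
      intro z
      obtain ⟨⟨q, hq⟩, rfl⟩ := QuotientGroup.mk_surjective z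
      rw [isOfFinOrder_iff_pow_eq_one]
      let d : ℕ := ∏ i, (q.toAdd i).den
      have hd : ∀ i, ∃ a : ℤ, (d : ℚ) * q.toAdd i = a := by
        intro i
        obtain ⟨c, hc⟩ := Finset.dvd_prod_of_mem (fun i => (q.toAdd i).den) (Finset.mem_univ i)
        refine ⟨c * (q.toAdd i).num, ?_⟩
        simp only [d, hc]
        push_cast
        rw [← Rat.mul_den_eq_num]
        ring
      choose a ha using hd
      refine ⟨d * m, Nat.mul_pos (Finset.prod_pos fun i _ => Rat.den_pos _) hm, ?_⟩
      rw [← QuotientGroup.mk_pow, QuotientGroup.eq_one_iff, Subgroup.mem_subgroupOf]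
      refine ⟨Multiplicative.ofAdd a, Multiplicative.toAdd.injective ?_⟩
      refine (hτ _).trans (funext fun i => ?_)
      rw [toAdd_ofAdd, ← ha]
      simp
      ring
    have := CommGroup.finite_of_fg_isMulTorsion (τ.range ⧸ B) htor
    exact Subgroup.index_ne_zero_of_finite
  let e := MonoidHom.ofInjective hf
  have : Group.FG f.range := inferInstance
  -- The image of `f` is finitely generated, being of finite index in `K`, and it projects onto
  -- `τ.ker`.
  have : Group.FG τ.ker := Group.fg_of_surjective
    (f := (MonoidHom.snd _ _).comp e.symm.toMonoidHom) (Prod.snd_surjective.comp e.symm.surjective)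
  obtain ⟨r, ⟨c⟩⟩ := IsFreeGroup.nonempty_mulEquiv_fin (G := τ.ker)
  exact ⟨f.range, hfin, r, ⟨e.symm.trans ((MulEquiv.refl _).prodCongr c)⟩⟩

theorem mainTheorem8 {n : ℕ} (hn : 1 ≤ n) {G : Type*} [Group G] (D : GBSDecomposition n G)
    (b : D.Base) (hfin : (b.monodromy : Set (GL (Fin n) ℚ)).Finite) :
    ∃ H : Subgroup G, H.FiniteIndex ∧
      ∃ r : ℕ, Nonempty (H ≃* Multiplicative (Fin n → ℤ) × FreeGroup (Fin r)) := by
  have := D.fg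
  have : Finite b.modularHom.range := hfin.to_subtype
  have hK : b.modularHom.ker.FiniteIndex := Subgroup.finiteIndex_ker _
  have hfg : Group.FG b.modularHom.ker := inferInstance
  obtain ⟨m, hm, hcomm⟩ := b.exists_commute_pow_of_fg ((Group.fg_iff_subgroup_fg _).1 hfg)
  have := b.isFreeGroup_ker_translationHom
  -- The central ℤ^n: the m-th powers of the base subgroup.
  let s : Multiplicative (Fin n → ℤ) →* b.modularHom.ker :=
    { toFun := fun x => ⟨b.elem (m • x.toAdd), GBSDecomposition.Base.modularHom_elem _⟩
      map_one' := Subtype.ext (by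
        simp [GBSDecomposition.Base.elem_zero])
      map_mul' := fun x y => Subtype.ext (by
        refine Eq.trans ?_ (b.elem_add (m • x.toAdd) (m • y.toAdd))
        rw [← smul_add, ← toAdd_mul]) }
  obtain ⟨H, hH, r, ⟨e⟩⟩ := exists_finiteIndex_range_of_central b.translationHom s
    (fun x k => Subtype.ext (by
      have := hcomm k k.2 x.toAdd
      rw [← b.elem_nsmul] at this
      exact this.symm.eq)) hm
    (fun x => by
      refine (congrArg Multiplicative.toAdd (b.translationHom_elem _)).trans (funext fun i => ?_)
      simp)
  refine ⟨H.map b.modularHom.ker.subtype, ⟨?_⟩, r,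
    ⟨(H.equivMapOfInjective _ (Subgroup.subtype_injective _)).symm.trans e⟩⟩
  rw [Subgroup.index_map_subtype]
  exact mul_ne_zero hH.index_ne_zero hK.index_ne_zero
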